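/- Let $(\mathcal C,\mathbb E,\mathfrak s)$ be an extriangulated category in the sense of Nakaoka and Palu: $\mathcal C$ is an additive category, $\mathbb E:\mathcal C^{\mathrm{op}}\times\mathcal C\to\mathbf{Ab}$ an additive bifunctor and $\mathfrak s$ an additive realization of $\mathbb E$, satisfying (ET3), (ET3)$^{\mathrm{op}}$, (ET4) and (ET4)$^{\mathrm{op}}$. If $\delta\in\mathbb E(Z,X)$ is realized by $X\xrightarrow{f}Y\xrightarrow{g}Z$, one calls $X\xrightarrow{f}Y\xrightarrow{g}Z\overset{\delta}{\dashrightarrow}$ an $\mathbb E$-triangle, $f$ an $\mathbb E$-inflation and $g$ an $\mathbb E$-deflation. A morphism of $\mathbb E$-triangles from $X\xrightarrow{f}Y\xrightarrow{g}Z\overset{\delta}{\dashrightarrow}$ to $X'\xrightarrow{f'}Y'\xrightarrow{g'}Z'\overset{\delta'}{\dashrightarrow}$ is a triple $(\alpha,\beta,\gamma)$ with $\beta f=f'\alpha$, $\gamma g=g'\beta$ and $\alpha_*\delta=\gamma^*\delta'$. A morphism $f':A'\to B'$ is a retract of $f:A\to B$ if there are $i:A'\to A$, $p:A\to A'$, $j:B'\to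 B$, $q:B\to B'$ with $fi=jf'$, $f'p=qf$, $pi=1_{A'}$ and $qj=1_{B'}$. The following statements are equivalent. (1) $\mathcal C$ is weakly idempotent complete, i.e. every section (morphism having a left inverse) has a cokernel. (2) For all $f:X\to Y$ and $g:Y\to Z$, if $gf$ is an $\mathbb E$-inflation, then so is $f$. (2)$'$ For all $f:X\to Y$ and $g:Y\to Z$, if $gf$ is an $\mathbb E$-deflation, then so is $g$. (3) The class of $\mathbb E$-inflations is closed under retracts. (3)$'$ The class of $\mathbb E$-deflations is closed under retracts. (4) For all $i:X\to Y$ and $Z\in\mathcal C$, if $\begin{pmatrix} i\\0\end{pmatrix}:X\to Y\oplus Z$ is an $\mathbb E$-inflation, then so is $i$. (4)$'$ For all $p:X\to Y$ and $Z\in\mathcal C$, if $(p,0):X\oplus Z\to Y$ is an $\mathbb E$-deflation, then so is $p$. (5) ($3\times3$ Lemma) For all $\mathbb E$-triangles $A_1\xrightarrow{f_A}A_2\xrightarrow{g_A}A_3\overset{\delta_A}{\dashrightarrow}$, $B_1\xrightarrow{f_B}B_2\xrightarrow{g_B}B_3\overset{\delta_B}{\dashrightarrow}$, $A_2\xrightarrow{i_2}B_2\xrightarrow{p_2}C_2\overset{\varepsilon_2}{\dashrightarrow}$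 and $A_3\xrightarrow{i_3}B_3\xrightarrow{p_3}C_3\overset{\varepsilon_3}{\dashrightarrow}$ with $g_Bi_2=i_3g_A$, there are $\mathbb E$-triangles $A_1\xrightarrow{i_1}B_1\xrightarrow{p_1}C_1\overset{\varepsilon_1}{\dashrightarrow}$ and $C_1\xrightarrow{f_C}C_2\xrightarrow{g_C}C_3\overset{\delta_C}{\dashrightarrow}$ such that $(i_1,i_2,i_3)$ (from the $A$-row to the $B$-row), $(p_1,p_2,p_3)$ (from the $B$-row to the $C$-row), $(f_A,f_B,f_C)$ (from the first to the second column) and $(g_A,g_B,g_C)$ (from the second to the third column) are morphisms of $\mathbb E$-triangles. -/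

import Mathlib

open CategoryTheory CategoryTheory.Limits Opposite

universe w v u

namespace Extri

/-- A sequence `X ⟶ Y ⟶ Z` with prescribed end terms. -/
structure Seq {C : Type u} [Category.{v} C] (X Z : C) where
  mid : C
  f : X ⟶ mid
  g : mid ⟶ Z

/-- Two sequences with the same end terms are equivalent if there is an isomorphism of the middle
terms which is compatible with the identities of the end terms. -/
def Seq.Equiv {C : Type u} [Category.{v} C] {X Z : C} (S T : Seq X Z) : Prop :=
  ∃ φ : S.mid ≅ T.mid, S.f ≫ φ.hom = T.f ∧ φ.hom ≫ T.g = S.g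

instance Seq.setoid {C : Type u} [Category.{v} C] (X Z : C) : Setoid (Seq X Z) where
  r := Seq.Equiv
  iseqv :=
    { refl := fun S => ⟨Iso.refl _, by simp, by simp⟩
      symm := by
        rintro S T ⟨φ, h₁, h₂⟩
        exact ⟨φ.symm, by simp [← h₁], by simp [← h₂]⟩
      trans := by
        rintro S T U ⟨φ, h₁, h₂⟩ ⟨ψ, h₃, h₄⟩
        exact ⟨φ ≪≫ ψ, by simp [← h₃, ← h₁], by simp [h₄, h₂]⟩ }

/-- The data underlying an extriangulated category: an additive bifunctor
`𝔼 : Cᵒᵖ × C → Ab` (in curried form) and an assignment `𝔰` sending every `δ ∈ 𝔼(Z, X)` to an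
equivalence class of sequences `X ⟶ Y ⟶ Z`. -/
structure ExtData (C : Type u) [Category.{v} C] [Preadditive C] where
  E : Cᵒᵖ ⥤ C ⥤ AddCommGrpCat.{w}
  additive_left : E.Additive
  additive_right : ∀ Z : Cᵒᵖ, (E.obj Z).Additive
  s : ∀ {X Z : C}, ((E.obj (op Z)).obj X) → Quotient (Seq.setoid X Z)

namespace ExtData

variable {C : Type u} [Category.{v} C] [Preadditive C] (𝓓 : ExtData.{w} C)

/-- The group `𝔼(Z, X)` of extensions. -/
abbrev Ext (Z X : C) : Type w := (𝓓.E.obj (op Z)).obj X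

variable {𝓓}

/-- `α_* δ ∈ 𝔼(Z, X')` for `α : X ⟶ X'` and `δ ∈ 𝔼(Z, X)`. -/
def push {Z X X' : C} (α : X ⟶ X') (δ : 𝓓.Ext Z X) : 𝓓.Ext Z X' :=
  ((𝓓.E.obj (op Z)).map α).hom δ

/-- `γ^* δ ∈ 𝔼(Z', X)` for `γ : Z' ⟶ Z` and `δ ∈ 𝔼(Z, X)`. -/
def pull {Z Z' X : C} (γ : Z' ⟶ Z) (δ : 𝓓.Ext Z X) : 𝓓.Ext Z' X :=
  ((𝓓.E.map γ.op).app X).hom δ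

/-- `δ ⊕ δ' ∈ 𝔼(Z ⊕ Z', X ⊕ X')`: the extension with components `δ`, `δ'` and zero
off-diagonal components. -/
noncomputable def directSum [HasBinaryBiproducts C] {Z X Z' X' : C}
    (δ : 𝓓.Ext Z X) (δ' : 𝓓.Ext Z' X') : 𝓓.Ext (Z ⊞ Z') (X ⊞ X') :=
  push biprod.inl (pull biprod.fst δ) + push biprod.inr (pull biprod.snd δ')

variable (𝓓)

/-- `δ` is realized by `X ⟶ Y ⟶ Z`, i.e. these form an `𝔼`-triangle. -/
def IsTriangle {X Y Z : C} (f : X ⟶ Y) (g : Y ⟶ Z) (δ : 𝓓.Ext Z X) : Prop :=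
  𝓓.s δ = Quotient.mk (Seq.setoid X Z) ⟨Y, f, g⟩

/-- The class of `𝔼`-inflations. -/
def inflations : MorphismProperty C := fun X Y f =>
  ∃ (Z : C) (g : Y ⟶ Z) (δ : 𝓓.Ext Z X), 𝓓.IsTriangle f g δ

/-- The class of `𝔼`-deflations. -/
def deflations : MorphismProperty C := fun Y Z g =>
  ∃ (X : C) (f : X ⟶ Y) (δ : 𝓓.Ext Z X), 𝓓.IsTriangle f g δ

/-- `(α, β, γ)` is a morphism from the `𝔼`-triangle `X ⟶ Y ⟶ Z`, `δ` to the `𝔼`-triangle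
`X' ⟶ Y' ⟶ Z'`, `δ'`. -/
structure IsTriangleMor {X Y Z X' Y' Z' : C}
    (f : X ⟶ Y) (g : Y ⟶ Z) (δ : 𝓓.Ext Z X)
    (f' : X' ⟶ Y') (g' : Y' ⟶ Z') (δ' : 𝓓.Ext Z' X')
    (α : X ⟶ X') (β : Y ⟶ Y') (γ : Z ⟶ Z') : Prop where
  comm₁ : f ≫ β = α ≫ f'
  comm₂ : g ≫ γ = β ≫ g'
  ext_eq : push α δ = pull γ δ'

/-- A `3 × 3` diagram: the three rows `A`, `B`, `C` and the three columns are `𝔼`-triangles,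
and the columns, as well as the rows, are connected by morphisms of `𝔼`-triangles. -/
structure IsThreeByThree {A₁ A₂ A₃ B₁ B₂ B₃ C₁ C₂ C₃ : C}
    (fA : A₁ ⟶ A₂) (gA : A₂ ⟶ A₃) (δA : 𝓓.Ext A₃ A₁)
    (fB : B₁ ⟶ B₂) (gB : B₂ ⟶ B₃) (δB : 𝓓.Ext B₃ B₁)
    (fC : C₁ ⟶ C₂) (gC : C₂ ⟶ C₃) (δC : 𝓓.Ext C₃ C₁)
    (i₁ : A₁ ⟶ B₁) (p₁ : B₁ ⟶ C₁) (ε₁ : 𝓓.Ext C₁ A₁)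
    (i₂ : A₂ ⟶ B₂) (p₂ : B₂ ⟶ C₂) (ε₂ : 𝓓.Ext C₂ A₂)
    (i₃ : A₃ ⟶ B₃) (p₃ : B₃ ⟶ C₃) (ε₃ : 𝓓.Ext C₃ A₃) : Prop where
  rowA : 𝓓.IsTriangle fA gA δA
  rowB : 𝓓.IsTriangle fB gB δB
  rowC : 𝓓.IsTriangle fC gC δC
  col₁ : 𝓓.IsTriangle i₁ p₁ ε₁
  col₂ : 𝓓.IsTriangle i₂ p₂ ε₂
  col₃ : 𝓓.IsTriangle i₃ p₃ ε₃
  mor_i : 𝓓.IsTriangleMor fA gA δA fB gB δB i₁ i₂ i₃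
  mor_p : 𝓓.IsTriangleMor fB gB δB fC gC δC p₁ p₂ p₃
  mor_f : 𝓓.IsTriangleMor i₁ p₁ ε₁ i₂ p₂ ε₂ fA fB fC
  mor_g : 𝓓.IsTriangleMor i₂ p₂ ε₂ i₃ p₃ ε₃ gA gB gC

/-- The `3 × 3` Lemma: rows `A`, `B` and columns `2`, `3` with commuting common square can be
completed to a `3 × 3` diagram. -/
def ThreeByThreeLemma : Prop :=
  ∀ ⦃A₁ A₂ A₃ B₁ B₂ B₃ C₂ C₃ : C⦄
    (fA : A₁ ⟶ A₂) (gA : A₂ ⟶ A₃) (δA : 𝓓.Ext A₃ A₁)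
    (fB : B₁ ⟶ B₂) (gB : B₂ ⟶ B₃) (δB : 𝓓.Ext B₃ B₁)
    (i₂ : A₂ ⟶ B₂) (p₂ : B₂ ⟶ C₂) (ε₂ : 𝓓.Ext C₂ A₂)
    (i₃ : A₃ ⟶ B₃) (p₃ : B₃ ⟶ C₃) (ε₃ : 𝓓.Ext C₃ A₃),
    𝓓.IsTriangle fA gA δA → 𝓓.IsTriangle fB gB δB →
    𝓓.IsTriangle i₂ p₂ ε₂ → 𝓓.IsTriangle i₃ p₃ ε₃ →
    i₂ ≫ gB = gA ≫ i₃ →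
    ∃ (C₁ : C) (fC : C₁ ⟶ C₂) (gC : C₂ ⟶ C₃) (δC : 𝓓.Ext C₃ C₁)
      (i₁ : A₁ ⟶ B₁) (p₁ : B₁ ⟶ C₁) (ε₁ : 𝓓.Ext C₁ A₁),
      𝓓.IsThreeByThree fA gA δA fB gB δB fC gC δC i₁ p₁ ε₁ i₂ p₂ ε₂ i₃ p₃ ε₃

end ExtData

/-- An extriangulated category structure (Nakaoka–Palu) on an additive category `C`. -/
structure Extriangulated (C : Type u) [Category.{v} C] [Preadditive C] [HasZeroObject C]
    [HasBinaryBiproducts C] extends ExtData.{w} C where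
  /-- `𝔰` is a realization: morphisms of extensions lift to representatives. -/
  realization : ∀ {X Y Z X' Y' Z' : C} (f : X ⟶ Y) (g : Y ⟶ Z) (δ : toExtData.Ext Z X)
    (f' : X' ⟶ Y') (g' : Y' ⟶ Z') (δ' : toExtData.Ext Z' X') (α : X ⟶ X') (γ : Z ⟶ Z'),
    toExtData.IsTriangle f g δ → toExtData.IsTriangle f' g' δ' →
    ExtData.push α δ = ExtData.pull γ δ' →
    ∃ β : Y ⟶ Y', f ≫ β = α ≫ f' ∧ g ≫ γ = β ≫ g'
  /-- `𝔰` is additive: split extensions are realized by the split sequences, -/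
  realize_zero : ∀ X Y : C,
    toExtData.IsTriangle (biprod.inl : X ⟶ X ⊞ Y) (biprod.snd : X ⊞ Y ⟶ Y) 0
  /-- and direct sums of extensions are realized by direct sums of sequences. -/
  realize_directSum : ∀ {X₁ Y₁ Z₁ X₂ Y₂ Z₂ : C}
    (f₁ : X₁ ⟶ Y₁) (g₁ : Y₁ ⟶ Z₁) (δ₁ : toExtData.Ext Z₁ X₁)
    (f₂ : X₂ ⟶ Y₂) (g₂ : Y₂ ⟶ Z₂) (δ₂ : toExtData.Ext Z₂ X₂),
    toExtData.IsTriangle f₁ g₁ δ₁ → toExtData.IsTriangle f₂ g₂ δ₂ →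
    toExtData.IsTriangle (biprod.map f₁ f₂) (biprod.map g₁ g₂) (ExtData.directSum δ₁ δ₂)
  /-- (ET3) -/
  et3 : ∀ {X Y Z X' Y' Z' : C} (f : X ⟶ Y) (g : Y ⟶ Z) (δ : toExtData.Ext Z X)
    (f' : X' ⟶ Y') (g' : Y' ⟶ Z') (δ' : toExtData.Ext Z' X') (α : X ⟶ X') (β : Y ⟶ Y'),
    toExtData.IsTriangle f g δ → toExtData.IsTriangle f' g' δ' → f ≫ β = α ≫ f' →
    ∃ γ : Z ⟶ Z', toExtData.IsTriangleMor f g δ f' g' δ' α β γ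
  /-- (ET3)ᵒᵖ -/
  et3_op : ∀ {X Y Z X' Y' Z' : C} (f : X ⟶ Y) (g : Y ⟶ Z) (δ : toExtData.Ext Z X)
    (f' : X' ⟶ Y') (g' : Y' ⟶ Z') (δ' : toExtData.Ext Z' X') (β : Y ⟶ Y') (γ : Z ⟶ Z'),
    toExtData.IsTriangle f g δ → toExtData.IsTriangle f' g' δ' → g ≫ γ = β ≫ g' →
    ∃ α : X ⟶ X', toExtData.IsTriangleMor f g δ f' g' δ' α β γ
  /-- (ET4) -/
  et4 : ∀ {A B D M N : C} (f : A ⟶ B) (g : B ⟶ D) (δ : toExtData.Ext D A)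
    (a : B ⟶ M) (b : M ⟶ N) (ε : toExtData.Ext N B),
    toExtData.IsTriangle f g δ → toExtData.IsTriangle a b ε →
    ∃ (F : C) (m : A ⟶ M) (h : M ⟶ F) (θ : toExtData.Ext F A)
      (c : D ⟶ F) (q : F ⟶ N) (η : toExtData.Ext N D),
      toExtData.IsTriangle m h θ ∧ toExtData.IsTriangle c q η ∧
      f ≫ a = m ∧ a ≫ h = g ≫ c ∧ h ≫ q = b ∧
      ExtData.pull c θ = δ ∧ ExtData.push g ε = η ∧ ExtData.push f θ = ExtData.pull q ε
  /-- (ET4)ᵒᵖ -/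
  et4_op : ∀ {A D M N F : C} (m : A ⟶ M) (h : M ⟶ F) (θ : toExtData.Ext F A)
    (c : D ⟶ F) (q : F ⟶ N) (η : toExtData.Ext N D),
    toExtData.IsTriangle m h θ → toExtData.IsTriangle c q η →
    ∃ (B : C) (f : A ⟶ B) (g : B ⟶ D) (δ : toExtData.Ext D A)
      (a : B ⟶ M) (b : M ⟶ N) (ε : toExtData.Ext N B),
      toExtData.IsTriangle f g δ ∧ toExtData.IsTriangle a b ε ∧
      f ≫ a = m ∧ a ≫ h = g ≫ c ∧ h ≫ q = b ∧
      ExtData.pull c θ = δ ∧ ExtData.push g ε = η ∧ ExtData.push f θ = ExtData.pull q ε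

/-- Weak idempotent completeness: every section has a cokernel. -/
def WeaklyIdempotentComplete (C : Type u) [Category.{v} C] [Preadditive C] : Prop :=
  ∀ ⦃A B : C⦄ (φ : A ⟶ B), (∃ ψ : B ⟶ A, φ ≫ ψ = 𝟙 A) → HasCokernel φ

end Extri

/-! Weak idempotent completeness is what allows a trivial direct summand to be split off an
`𝔼`-triangle. If (i, 0) : X → Y ⊕ Z is an inflation with third term W, the projection to Z factors
through W and makes Z a retract of W. A complement D of Z in W turns the triangle into the sum of X
→ Y → D and 0 → Z = Z, and such a summand cancels in any extriangulated category
(`isTriangle_of_biprod_map_id'`). A shear reduces cancellation to this case: if gf is an inflation,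
so is (f, gf), hence (f, 0). Conversely, cancellation makes every section an inflation, its
composite with a retraction being an identity, and the resulting triangle splits.

For the 3 × 3 Lemma, (ET4)ᵒᵖ yields a weak pullback K of B₂ → B₃ ← A₃. The map A₂ → B₂ factors
through some l : A₂ → K, an inflation by cancellation. Then (ET4) provides the third row and
`exists_inflation_of_inflation_mid` the first column. Conversely, the diagram with rows X = X → 0
and Y → Y ⊕ Z → Z and second column starting with (i, 0) has i in its first column. -/

namespace Extri

namespace ExtData

/-! ### Calculus of the bifunctor `𝔼` and its realizations -/

section Bifunctor

variable {C : Type u} [Category.{v} C] [Preadditive C] {𝓓 : ExtData.{w} C}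

@[simp]
lemma push_add {Z X X' : C} (α : X ⟶ X') (δ δ' : 𝓓.Ext Z X) :
    push α (δ + δ') = push α δ + push α δ' :=
  map_add _ _ _

@[simp]
lemma push_zero {Z X X' : C} (α : X ⟶ X') : push α (0 : 𝓓.Ext Z X) = 0 :=
  map_zero _

@[simp]
lemma push_neg {Z X X' : C} (α : X ⟶ X') (δ : 𝓓.Ext Z X) : push α (-δ) = -push α δ :=
  map_neg _ _

@[simp]
lemma pull_zero {Z Z' X : C} (γ : Z' ⟶ Z) : pull γ (0 : 𝓓.Ext Z X) = 0 :=
  map_zero _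

@[simp]
lemma push_id {Z X : C} (δ : 𝓓.Ext Z X) : push (𝟙 X) δ = δ := by
  simp [push]

@[simp]
lemma pull_id {Z X : C} (δ : 𝓓.Ext Z X) : pull (𝟙 Z) δ = δ := by
  simp [pull]

lemma push_comp {Z X X' X'' : C} (α : X ⟶ X') (β : X' ⟶ X'') (δ : 𝓓.Ext Z X) :
    push (α ≫ β) δ = push β (push α δ) := by
  simp [push]

lemma pull_comp {Z Z' Z'' X : C} (γ : Z' ⟶ Z) (β : Z'' ⟶ Z') (δ : 𝓓.Ext Z X) :
    pull (β ≫ γ) δ = pull β (pull γ δ) := by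
  simp [pull]

lemma push_pull {Z Z' X X' : C} (α : X ⟶ X') (γ : Z' ⟶ Z) (δ : 𝓓.Ext Z X) :
    push α (pull γ δ) = pull γ (push α δ) :=
  (ConcreteCategory.congr_hom ((𝓓.E.map γ.op).naturality α) δ).symm

lemma add_push {Z X X' : C} (α β : X ⟶ X') (δ : 𝓓.Ext Z X) :
    push (α + β) δ = push α δ + push β δ := by
  have := 𝓓.additive_right (op Z)
  simp [push, Functor.map_add]

lemma add_pull {Z Z' X : C} (γ β : Z' ⟶ Z) (δ : 𝓓.Ext Z X) :
    pull (γ + β) δ = pull γ δ + pull β δ := by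
  have := 𝓓.additive_left
  simp [pull, Functor.map_add]

@[simp]
lemma zero_push {Z X X' : C} (δ : 𝓓.Ext Z X) : push (0 : X ⟶ X') δ = 0 := by
  simpa using add_push (0 : X ⟶ X') 0 δ

@[simp]
lemma zero_pull {Z Z' X : C} (δ : 𝓓.Ext Z X) : pull (0 : Z' ⟶ Z) δ = 0 := by
  simpa using add_pull (0 : Z' ⟶ Z) 0 δ

lemma neg_push {Z X X' : C} (α : X ⟶ X') (δ : 𝓓.Ext Z X) : push (-α) δ = -push α δ := by
  rw [eq_neg_iff_add_eq_zero, ← add_push, neg_add_cancel, zero_push]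

lemma neg_pull {Z Z' X : C} (γ : Z' ⟶ Z) (δ : 𝓓.Ext Z X) : pull (-γ) δ = -pull γ δ := by
  rw [eq_neg_iff_add_eq_zero, ← add_pull, neg_add_cancel, zero_pull]

lemma sub_push {Z X X' : C} (α β : X ⟶ X') (δ : 𝓓.Ext Z X) :
    push (α - β) δ = push α δ - push β δ := by
  rw [sub_eq_add_neg, add_push, neg_push, sub_eq_add_neg]

lemma sub_pull {Z Z' X : C} (γ β : Z' ⟶ Z) (δ : 𝓓.Ext Z X) :
    pull (γ - β) δ = pull γ δ - pull β δ := by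
  rw [sub_eq_add_neg, add_pull, neg_pull, sub_eq_add_neg]

lemma exists_isTriangle {X Z : C} (δ : 𝓓.Ext Z X) :
    ∃ (Y : C) (f : X ⟶ Y) (g : Y ⟶ Z), 𝓓.IsTriangle f g δ := by
  obtain ⟨⟨Y, f, g⟩, h⟩ := Quotient.exists_rep (𝓓.s δ)
  exact ⟨Y, f, g, h.symm⟩

lemma IsTriangle.exists_iso {X Y Y' Z : C} {f : X ⟶ Y} {g : Y ⟶ Z} {f' : X ⟶ Y'} {g' : Y' ⟶ Z}
    {δ : 𝓓.Ext Z X} (h : 𝓓.IsTriangle f g δ) (h' : 𝓓.IsTriangle f' g' δ) :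
    ∃ φ : Y ≅ Y', f ≫ φ.hom = f' ∧ φ.hom ≫ g' = g :=
  Quotient.exact (h.symm.trans h')

lemma IsTriangle.of_mid_iso {X Y Y' Z : C} {f : X ⟶ Y} {g : Y ⟶ Z} {f' : X ⟶ Y'} {g' : Y' ⟶ Z}
    {δ : 𝓓.Ext Z X} (h : 𝓓.IsTriangle f g δ) (φ : Y ≅ Y') (hf : f ≫ φ.hom = f')
    (hg : φ.hom ≫ g' = g) : 𝓓.IsTriangle f' g' δ :=
  h.trans (Quotient.sound ⟨φ, hf, hg⟩)

end Bifunctor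

end ExtData

/-- If (1 - u)² = 0 then u(2 - u) = 1; applied to both composites of a and b, this gives one-sided
inverses of a on either side. It replaces the five lemma below, where comparison maps are inverse
only up to square-zero errors. -/
lemma isIso_of_comp_add_sq_zero {C : Type u} [Category.{v} C] [Preadditive C] {X Y : C}
    (a : X ⟶ Y) (b : Y ⟶ X) (h : (𝟙 X - a ≫ b) ≫ (𝟙 X - a ≫ b) = 0)
    (h' : (𝟙 Y - b ≫ a) ≫ (𝟙 Y - b ≫ a) = 0) : IsIso a := by
  have h₁ : a ≫ (b ≫ (2 • 𝟙 X - a ≫ b)) = 𝟙 X := by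
    simp only [Preadditive.sub_comp, Preadditive.comp_sub, Category.id_comp, Category.comp_id,
      Category.assoc, two_smul, Preadditive.comp_add] at h ⊢
    rw [← sub_eq_zero, ← neg_eq_zero, ← h]
    abel
  have h₂ : ((2 • 𝟙 Y - b ≫ a) ≫ b) ≫ a = 𝟙 Y := by
    simp only [Preadditive.sub_comp, Preadditive.comp_sub, Category.id_comp, Category.comp_id,
      Category.assoc, two_smul, Preadditive.add_comp] at h' ⊢
    rw [← sub_eq_zero, ← neg_eq_zero, ← h']
    abel
  have : IsSplitMono a := ⟨⟨_, h₁⟩⟩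
  have : IsSplitEpi a := ⟨⟨_, h₂⟩⟩
  exact isIso_of_mono_of_isSplitEpi a

/-- A section whose complementary idempotent splits has a cokernel. -/
lemma hasCokernel_of_complement {C : Type u} [Category.{v} C] [Preadditive C] {A B D : C}
    (φ : A ⟶ B) (ψ : B ⟶ A) (ρ : B ⟶ D) (x : D ⟶ B) (h : φ ≫ ρ = 0) (hx : x ≫ ρ = 𝟙 D)
    (hρ : ρ ≫ x = 𝟙 B - ψ ≫ φ) : HasCokernel φ :=
  ⟨⟨⟨CokernelCofork.ofπ ρ h, CokernelCofork.IsColimit.ofπ _ _ (fun t _ => x ≫ t)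
    (fun t ht => by rw [← Category.assoc, hρ]; simp [ht])
    (fun t ht m hm => by rw [← hm, ← Category.assoc, hx, Category.id_comp])⟩⟩⟩

/-- The idempotent `𝟙 B - ψ ≫ φ` vanishes on φ, so it factors through the cokernel; cancelling the
epimorphism `cokernel.π φ` shows that this factorization splits it. -/
lemma WeaklyIdempotentComplete.exists_complement {C : Type u} [Category.{v} C] [Preadditive C]
    (hC : WeaklyIdempotentComplete C) {A B : C} (φ : A ⟶ B) (ψ : B ⟶ A) (h : φ ≫ ψ = 𝟙 A) :
    ∃ (D : C) (ρ : B ⟶ D) (x : D ⟶ B), φ ≫ ρ = 0 ∧ x ≫ ρ = 𝟙 D ∧ x ≫ ψ = 0 ∧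
      ρ ≫ x = 𝟙 B - ψ ≫ φ := by
  have := hC φ ⟨ψ, h⟩
  have hx : cokernel.π φ ≫ cokernel.desc φ (𝟙 B - ψ ≫ φ) (by simp [reassoc_of% h]) =
    𝟙 B - ψ ≫ φ := by simp
  refine ⟨cokernel φ, cokernel.π φ, cokernel.desc φ (𝟙 B - ψ ≫ φ) (by simp [reassoc_of% h]),
    by simp, ?_, ?_, hx⟩
  · rw [← cancel_epi (cokernel.π φ), reassoc_of% hx]
    simp
  · rw [← cancel_epi (cokernel.π φ), reassoc_of% hx]
    simp [h]

namespace Extriangulated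

open ExtData

variable {C : Type u} [Category.{v} C] [Preadditive C] [HasZeroObject C] [HasBinaryBiproducts C]
  {𝓔 : Extriangulated.{w} C}

/-! ### Exactness, by comparison with split triangles -/

section Exactness

variable {X Y Z : C} {f : X ⟶ Y} {g : Y ⟶ Z} {δ : 𝓔.Ext Z X}

open ZeroObject

lemma push_self_eq_zero (h : 𝓔.IsTriangle f g δ) : push f δ = 0 := by
  obtain ⟨γ, hγ⟩ := 𝓔.et3 f g δ _ _ _ f biprod.inl h (𝓔.realize_zero Y 0) rfl
  simpa using hγ.ext_eq

lemma pull_self_eq_zero (h : 𝓔.IsTriangle f g δ) : pull g δ = 0 := by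
  obtain ⟨γ, hγ⟩ := 𝓔.et3_op _ _ _ f g δ biprod.snd g (𝓔.realize_zero 0 Y) h rfl
  simpa using hγ.ext_eq.symm

lemma comp_eq_zero (h : 𝓔.IsTriangle f g δ) : f ≫ g = 0 := by
  obtain ⟨γ, hγ⟩ := 𝓔.et3 _ _ _ f g δ (𝟙 X) (biprod.fst ≫ f) (𝓔.realize_zero X 0) h (by simp)
  simpa using congrArg (biprod.inl ≫ ·) hγ.comm₂.symm

lemma exists_desc (h : 𝓔.IsTriangle f g δ) {W : C} (t : Y ⟶ W) (ht : f ≫ t = 0) :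
    ∃ s : Z ⟶ W, g ≫ s = t := by
  obtain ⟨γ, hγ⟩ := 𝓔.et3 f g δ _ _ _ (0 : X ⟶ 0) (t ≫ biprod.inr) h (𝓔.realize_zero 0 W)
    (by simp [reassoc_of% ht])
  exact ⟨γ, by simpa using hγ.comm₂⟩

lemma exists_lift (h : 𝓔.IsTriangle f g δ) {W : C} (t : W ⟶ Y) (ht : t ≫ g = 0) :
    ∃ s : W ⟶ X, s ≫ f = t := by
  obtain ⟨α, hα⟩ := 𝓔.et3_op _ _ _ f g δ (biprod.fst ≫ t) (0 : 0 ⟶ Z) (𝓔.realize_zero W 0) h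
    (by simp [ht])
  exact ⟨α, by simpa using hα.comm₁.symm⟩

lemma exists_lift_of_pull_eq_zero (h : 𝓔.IsTriangle f g δ) {W : C} (t : W ⟶ Z)
    (ht : pull t δ = 0) : ∃ s : W ⟶ Y, s ≫ g = t := by
  obtain ⟨β, h₁, h₂⟩ := 𝓔.realization _ _ _ f g δ (𝟙 X) t (𝓔.realize_zero X W) h (by simp [ht])
  exact ⟨biprod.inr ≫ β, by simp [← h₂]⟩

lemma exists_desc_of_push_eq_zero (h : 𝓔.IsTriangle f g δ) {W : C} (t : X ⟶ W)
    (ht : push t δ = 0) : ∃ s : Y ⟶ W, f ≫ s = t := by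
  obtain ⟨β, h₁, h₂⟩ := 𝓔.realization f g δ _ _ _ t (𝟙 Z) h (𝓔.realize_zero W Z) (by simp [ht])
  exact ⟨β ≫ biprod.fst, by simp [reassoc_of% h₁]⟩

/-- An `𝔼`-triangle whose deflation has a section splits. -/
lemma exists_splitting (h : 𝓔.IsTriangle f g δ) (σ : Z ⟶ Y) (hσ : σ ≫ g = 𝟙 Z) :
    ∃ ρ : Y ⟶ X, f ≫ ρ = 𝟙 X ∧ σ ≫ ρ = 0 ∧ ρ ≫ f = 𝟙 Y - g ≫ σ := by
  have hδ : δ = 0 := by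
    rw [← pull_id δ, ← hσ, pull_comp, pull_self_eq_zero h, pull_zero]
  -- f is not known to be monic in advance, so a retraction r is found first; then `t = t ≫ f ≫ r =
  -- (𝟙 Y - g ≫ σ) ≫ r` determines t.
  obtain ⟨r, hr⟩ := exists_desc_of_push_eq_zero h (𝟙 X) (by simp [hδ])
  obtain ⟨t, ht⟩ := exists_lift h (𝟙 Y - g ≫ σ) (by simp [hσ])
  have hfg := comp_eq_zero h
  refine ⟨t, ?_, ?_, ht⟩
  · rw [← Category.comp_id t, ← hr, reassoc_of% ht]
    simp [reassoc_of% hfg, hr]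
  · rw [← Category.comp_id t, ← hr, reassoc_of% ht]
    simp [reassoc_of% hσ]

end Exactness

/-! ### Comparing triangles and transport along isomorphisms -/

/-- A morphism of `𝔼`-triangles which is the identity on the first terms makes its second square a
weak pullback. -/
lemma exists_weakPullback_lift {X Y Z Y' Z' : C} {f : X ⟶ Y} {g : Y ⟶ Z} {δ : 𝓔.Ext Z X}
    {f' : X ⟶ Y'} {g' : Y' ⟶ Z'} {δ' : 𝓔.Ext Z' X}
    (h : 𝓔.IsTriangle f g δ) (h' : 𝓔.IsTriangle f' g' δ') {β : Y ⟶ Y'} {γ : Z ⟶ Z'}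
    (hf : f ≫ β = f') (hg : β ≫ g' = g ≫ γ) (hδ : pull γ δ' = δ)
    {W : C} (a : W ⟶ Z) (b : W ⟶ Y') (hab : a ≫ γ = b ≫ g') :
    ∃ t : W ⟶ Y, t ≫ g = a ∧ t ≫ β = b := by
  obtain ⟨t, ht⟩ := exists_lift_of_pull_eq_zero h a (by
    rw [← hδ, ← pull_comp, hab, pull_comp, pull_self_eq_zero h', pull_zero])
  obtain ⟨u, hu⟩ := exists_lift h' (b - t ≫ β) (by simp [hg, reassoc_of% ht, hab])
  exact ⟨t + u ≫ f, by simp [comp_eq_zero h, ht], by simp [hf, hu]⟩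

/-- Lifting the inverses of the outer maps gives b backwards. The errors `𝟙 - β ≫ b` and `𝟙 - b ≫ β`
vanish after the inflation and before the deflation; hence they factor through the inflation and
square to zero. -/
lemma isIso_of_endpoints {X Y Z X' Y' Z' : C} {f : X ⟶ Y} {g : Y ⟶ Z} {δ : 𝓔.Ext Z X}
    {f' : X' ⟶ Y'} {g' : Y' ⟶ Z'} {δ' : 𝓔.Ext Z' X'}
    (h : 𝓔.IsTriangle f g δ) (h' : 𝓔.IsTriangle f' g' δ') (α : X ≅ X') (β : Y ⟶ Y') (γ : Z ≅ Z')
    (hm : 𝓔.IsTriangleMor f g δ f' g' δ' α.hom β γ.hom) : IsIso β := by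
  obtain ⟨b, hb₁, hb₂⟩ := 𝓔.realization f' g' δ' f g δ α.inv γ.inv h' h (by
    rw [← pull_id (push _ _), ← γ.inv_hom_id, pull_comp, ← push_pull, ← hm.ext_eq, ← push_comp,
      α.hom_inv_id, push_id])
  have sq : ∀ {A B D : C} {x : A ⟶ B} {y : B ⟶ D} {ε : 𝓔.Ext D A} (_ : 𝓔.IsTriangle x y ε)
      (n : B ⟶ B), x ≫ n = 0 → n ≫ y = 0 → n ≫ n = 0 := by
    intro A B D x y ε hε n h₁ h₂
    obtain ⟨t, rfl⟩ := exists_lift hε n h₂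
    rw [Category.assoc, h₁, comp_zero]
  have h₁ := hm.comm₁
  have h₂ := hm.comm₂
  refine isIso_of_comp_add_sq_zero β b (sq h _ ?_ ?_) (sq h' _ ?_ ?_)
  · simp [reassoc_of% h₁, hb₁]
  · simp [← hb₂, ← reassoc_of% h₂]
  · simp [reassoc_of% hb₁, h₁]
  · simp [← h₂, ← reassoc_of% hb₂]

lemma isTriangle_of_iso {X Y Z X' Y' Z' : C} {f : X ⟶ Y} {g : Y ⟶ Z} {δ : 𝓔.Ext Z X}
    (h : 𝓔.IsTriangle f g δ) {f' : X' ⟶ Y'} {g' : Y' ⟶ Z'} (α : X ≅ X') (β : Y ≅ Y') (γ : Z ≅ Z')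
    (hf : f ≫ β.hom = α.hom ≫ f') (hg : g ≫ γ.hom = β.hom ≫ g') :
    𝓔.IsTriangle f' g' (push α.hom (pull γ.inv δ)) := by
  obtain ⟨V, x, y, hV⟩ := exists_isTriangle (push α.hom (pull γ.inv δ))
  have hδ : push α.hom δ = pull γ.hom (push α.hom (pull γ.inv δ)) := by
    rw [push_pull, ← pull_comp, γ.hom_inv_id, pull_id]
  obtain ⟨b, hb₁, hb₂⟩ := 𝓔.realization f g δ x y _ α.hom γ.hom h hV hδ
  have := isIso_of_endpoints h hV α b γ ⟨hb₁, hb₂, hδ⟩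
  refine hV.of_mid_iso ((asIso b).symm ≪≫ β) ?_ ?_
  · have : x ≫ inv b = α.inv ≫ f := by rw [IsIso.comp_inv_eq, Category.assoc, hb₁]; simp
    simp [reassoc_of% this, hf]
  · simp [← hg, hb₂]

/-- Two `𝔼`-triangles with the same inflation have isomorphic third terms. -/
lemma exists_iso_of_same_inflation {X Y Z Z' : C} {f : X ⟶ Y} {g : Y ⟶ Z} {δ : 𝓔.Ext Z X}
    {g' : Y ⟶ Z'} {δ' : 𝓔.Ext Z' X} (h : 𝓔.IsTriangle f g δ) (h' : 𝓔.IsTriangle f g' δ') :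
    ∃ γ : Z ≅ Z', g ≫ γ.hom = g' ∧ pull γ.hom δ' = δ := by
  obtain ⟨a, ha⟩ := 𝓔.et3 f g δ f g' δ' (𝟙 X) (𝟙 Y) h h' (by simp)
  obtain ⟨b, hb⟩ := 𝓔.et3 f g' δ' f g δ (𝟙 X) (𝟙 Y) h' h (by simp)
  have sq : ∀ {A B D : C} {x : A ⟶ B} {y : B ⟶ D} {ε : 𝓔.Ext D A} (_ : 𝓔.IsTriangle x y ε)
      (n : D ⟶ D), y ≫ n = 0 → pull n ε = 0 → n ≫ n = 0 := by
    intro A B D x y ε hε n h₁ h₂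
    obtain ⟨t, rfl⟩ := exists_lift_of_pull_eq_zero hε n h₂
    rw [Category.assoc, h₁, comp_zero]
  have ha₁ : g ≫ a = g' := by simpa using ha.comm₂
  have hb₁ : g' ≫ b = g := by simpa using hb.comm₂
  have ha₂ : δ = pull a δ' := by simpa using ha.ext_eq
  have hb₂ : δ' = pull b δ := by simpa using hb.ext_eq
  have : IsIso a := by
    refine isIso_of_comp_add_sq_zero a b (sq h _ ?_ ?_) (sq h' _ ?_ ?_)
    · simp [reassoc_of% ha₁, hb₁]
    · rw [sub_pull, pull_comp, ← hb₂, ← ha₂]; simp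
    · simp [reassoc_of% hb₁, ha₁]
    · rw [sub_pull, pull_comp, ← ha₂, ← hb₂]; simp
  exact ⟨asIso a, ha₁, ha₂.symm⟩

/-! ### Trivial triangles: adding and cancelling them -/

section Basic

open ZeroObject

lemma isTriangle_id (X : C) : 𝓔.IsTriangle (𝟙 X) (0 : X ⟶ 0) 0 := by
  simpa using isTriangle_of_iso (𝓔.realize_zero X 0) (f' := 𝟙 X) (g' := (0 : X ⟶ 0)) (Iso.refl X)
    ⟨biprod.fst, biprod.inl, biprod.hom_ext _ _ (by simp) (by ext), by simp⟩
    (Iso.refl _) (by simp) (by ext)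

lemma isTriangle_id' (Z : C) : 𝓔.IsTriangle (0 : 0 ⟶ Z) (𝟙 Z) 0 := by
  simpa using isTriangle_of_iso (𝓔.realize_zero 0 Z) (f' := (0 : 0 ⟶ Z)) (g' := 𝟙 Z) (Iso.refl _)
    ⟨biprod.snd, biprod.inr, biprod.hom_ext _ _ (by ext) (by simp), by simp⟩
    (Iso.refl _) (by simp) (by simp)

lemma isTriangle_biprod_map_id {X Y Z : C} {f : X ⟶ Y} {g : Y ⟶ Z} {δ : 𝓔.Ext Z X}
    (h : 𝓔.IsTriangle f g δ) (W : C) :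
    𝓔.IsTriangle (biprod.map f (𝟙 W)) (biprod.desc g 0) (push biprod.inl δ) := by
  have := isTriangle_of_iso (𝓔.realize_directSum _ _ _ _ _ _ h (isTriangle_id W))
    (f' := biprod.map f (𝟙 W)) (g' := biprod.desc g 0) (Iso.refl _) (Iso.refl _)
    ⟨biprod.fst, biprod.inl, biprod.hom_ext _ _ (by simp) (by ext), by simp⟩
    (by simp) (by ext <;> simp)
  simpa [directSum, push_pull, ← pull_comp] using this

lemma isTriangle_biprod_map_id' {X Y Z : C} {f : X ⟶ Y} {g : Y ⟶ Z} {δ : 𝓔.Ext Z X}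
    (h : 𝓔.IsTriangle f g δ) (W : C) :
    𝓔.IsTriangle (biprod.lift f 0) (biprod.map g (𝟙 W)) (pull biprod.fst δ) := by
  have := isTriangle_of_iso (𝓔.realize_directSum _ _ _ _ _ _ h (isTriangle_id' W))
    (f' := biprod.lift f 0) (g' := biprod.map g (𝟙 W))
    ⟨biprod.fst, biprod.inl, biprod.hom_ext _ _ (by simp) (by ext), by simp⟩
    (Iso.refl _) (Iso.refl _) (by ext <;> simp) (by simp)
  simpa [directSum, ← push_comp] using this

end Basic

lemma isTriangle_neg {X Y Z : C} {f : X ⟶ Y} {g : Y ⟶ Z} {δ : 𝓔.Ext Z X}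
    (h : 𝓔.IsTriangle f g δ) : 𝓔.IsTriangle (-f) g (-δ) := by
  have := isTriangle_of_iso h (f' := -f) (g' := g) ⟨-𝟙 X, -𝟙 X, by simp, by simp⟩ (Iso.refl _)
    (Iso.refl _) (by simp) (by simp)
  simpa [neg_push] using this

/-- Pushing along f ⊕ 1 kills δ, so the W-component of δ vanishes and δ comes from X. Realizing the
X-component with middle term V and adding W = W → 0 gives V ⊕ W ≅ Y ⊕ W compatible with the
inclusions of W. This isomorphism is triangular with identity W-corner, so its other corner V → Y is
invertible. -/
lemma isTriangle_of_biprod_map_id {X Y Z W : C} {f : X ⟶ Y} {g : Y ⟶ Z} {δ : 𝓔.Ext Z (X ⊞ W)}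
    (h : 𝓔.IsTriangle (biprod.map f (𝟙 W)) (biprod.desc g 0) δ) :
    𝓔.IsTriangle f g (push biprod.fst δ) := by
  have h₂ : push biprod.snd δ = 0 := by
    have := congrArg (push biprod.snd) (push_self_eq_zero h)
    rw [← push_comp] at this
    simpa using this
  have hδ : push biprod.inl (push biprod.fst δ) = δ := by
    rw [← push_comp, ← sub_eq_zero, ← neg_eq_zero, neg_sub]
    nth_rw 1 [← push_id δ]
    rw [← sub_push, ← biprod.total, add_sub_cancel_left, push_comp, h₂, push_zero]
  obtain ⟨V, x, y, hV⟩ := exists_isTriangle (push biprod.fst δ)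
  have hW := isTriangle_biprod_map_id hV W
  rw [hδ] at hW
  obtain ⟨φ, h₁, h₂⟩ := hW.exists_iso h
  have e₁ : biprod.inr ≫ φ.hom = biprod.inr := by
    simpa using congrArg (biprod.inr ≫ ·) h₁
  have e₂ : biprod.inr ≫ φ.inv = biprod.inr := by
    rw [Iso.comp_inv_eq, e₁]
  refine hV.of_mid_iso ⟨biprod.inl ≫ φ.hom ≫ biprod.fst, biprod.inl ≫ φ.inv ≫ biprod.fst, ?_, ?_⟩
    ?_ ?_
  · have : φ.hom ≫ biprod.fst ≫ biprod.inl ≫ φ.inv ≫ biprod.fst = (biprod.fst : V ⊞ W ⟶ V) := by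
      have := biprod.total (X := Y) (Y := W)
      rw [← eq_sub_iff_add_eq] at this
      rw [reassoc_of% this]
      simp [reassoc_of% e₂]
    simp [this]
  · have : φ.inv ≫ biprod.fst ≫ biprod.inl ≫ φ.hom ≫ biprod.fst = (biprod.fst : Y ⊞ W ⟶ Y) := by
      have := biprod.total (X := V) (Y := W)
      rw [← eq_sub_iff_add_eq] at this
      rw [reassoc_of% this]
      simp [reassoc_of% e₁]
    simp [this]
  · simpa using congrArg (biprod.inl ≫ · ≫ biprod.fst) h₁
  · have e : (biprod.fst : Y ⊞ W ⟶ Y) ≫ g = biprod.desc g 0 := by ext <;> simp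
    simpa [e] using congrArg (biprod.inl ≫ ·) h₂

lemma isTriangle_of_biprod_map_id' {X Y Z W : C} {f : X ⟶ Y} {g : Y ⟶ Z} {δ : 𝓔.Ext (Z ⊞ W) X}
    (h : 𝓔.IsTriangle (biprod.lift f 0) (biprod.map g (𝟙 W)) δ) :
    𝓔.IsTriangle f g (pull biprod.inl δ) := by
  have h₂ : pull biprod.inr δ = 0 := by
    have := congrArg (pull biprod.inr) (pull_self_eq_zero h)
    rw [← pull_comp] at this
    simpa using this
  have hδ : pull biprod.fst (pull biprod.inl δ) = δ := by
    rw [← pull_comp, ← sub_eq_zero, ← neg_eq_zero, neg_sub]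
    nth_rw 1 [← pull_id δ]
    rw [← sub_pull, ← biprod.total, add_sub_cancel_left, pull_comp, h₂, pull_zero]
  obtain ⟨V, x, y, hV⟩ := exists_isTriangle (pull biprod.inl δ)
  have hW := isTriangle_biprod_map_id' hV W
  rw [hδ] at hW
  obtain ⟨φ, h₁, h₂⟩ := hW.exists_iso h
  have e₁ : φ.hom ≫ biprod.snd = biprod.snd := by
    simpa using congrArg (· ≫ biprod.snd) h₂
  have e₂ : φ.inv ≫ biprod.snd = biprod.snd := by
    rw [Iso.inv_comp_eq, e₁]
  refine hV.of_mid_iso ⟨biprod.inl ≫ φ.hom ≫ biprod.fst, biprod.inl ≫ φ.inv ≫ biprod.fst, ?_, ?_⟩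
    ?_ ?_
  · have : φ.hom ≫ biprod.fst ≫ biprod.inl ≫ φ.inv ≫ biprod.fst =
        (biprod.fst : V ⊞ W ⟶ V) - biprod.snd ≫ biprod.inr ≫ φ.inv ≫ biprod.fst := by
      have := biprod.total (X := Y) (Y := W)
      rw [← eq_sub_iff_add_eq] at this
      rw [reassoc_of% this]
      simp [reassoc_of% e₁]
    simp [this]
  · have : φ.inv ≫ biprod.fst ≫ biprod.inl ≫ φ.hom ≫ biprod.fst =
        (biprod.fst : Y ⊞ W ⟶ Y) - biprod.snd ≫ biprod.inr ≫ φ.hom ≫ biprod.fst := by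
      have := biprod.total (X := V) (Y := W)
      rw [← eq_sub_iff_add_eq] at this
      rw [reassoc_of% this]
      simp [reassoc_of% e₂]
    simp [this]
  · have e : x ≫ biprod.inl = biprod.lift x (0 : X ⟶ W) := by ext <;> simp
    simpa [reassoc_of% e] using congrArg (· ≫ biprod.fst) h₁
  · simpa using congrArg (biprod.inl ≫ · ≫ biprod.fst) h₂

/-! ### Closure properties and shears -/

section Classes

lemma inflations_comp {X Y Z : C} {f : X ⟶ Y} {g : Y ⟶ Z} (hf : 𝓔.inflations f)
    (hg : 𝓔.inflations g) : 𝓔.inflations (f ≫ g) := by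
  obtain ⟨D, p, δ, h⟩ := hf
  obtain ⟨N, b, ε, h'⟩ := hg
  obtain ⟨F, m, k, θ, c, q, η, hm, -, rfl, -⟩ := 𝓔.et4 f p δ g b ε h h'
  exact ⟨F, k, θ, hm⟩

lemma deflations_comp {X Y Z : C} {f : X ⟶ Y} {g : Y ⟶ Z} (hf : 𝓔.deflations f)
    (hg : 𝓔.deflations g) : 𝓔.deflations (f ≫ g) := by
  obtain ⟨A, m, θ, h⟩ := hf
  obtain ⟨D, c, η, h'⟩ := hg
  obtain ⟨B, x, y, δ, a, b, ε, -, hb, -, -, rfl, -⟩ := 𝓔.et4_op m f θ c g η h h'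
  exact ⟨B, a, ε, hb⟩

lemma inflations_comp_iso {X Y Y' : C} {f : X ⟶ Y} (hf : 𝓔.inflations f) (e : Y ≅ Y') :
    𝓔.inflations (f ≫ e.hom) := by
  obtain ⟨D, p, δ, h⟩ := hf
  exact ⟨D, e.inv ≫ p, δ, h.of_mid_iso e rfl (by simp)⟩

lemma deflations_iso_comp {X X' Y : C} {f : X ⟶ Y} (hf : 𝓔.deflations f) (e : X' ≅ X) :
    𝓔.deflations (e.hom ≫ f) := by
  obtain ⟨D, p, δ, h⟩ := hf
  exact ⟨D, p ≫ e.inv, δ, h.of_mid_iso e.symm rfl (by simp)⟩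

/-- The automorphism `(x, y) ↦ (x, y + r x)` of a biproduct. -/
@[simps]
noncomputable def shear {X Y : C} (r : X ⟶ Y) : X ⊞ Y ≅ X ⊞ Y where
  hom := biprod.lift biprod.fst (biprod.snd + biprod.fst ≫ r)
  inv := biprod.lift biprod.fst (biprod.snd - biprod.fst ≫ r)

/-- (f, a) is the sheared split inclusion (1, a) : X → X ⊕ D followed by f ⊕ 1. -/
lemma inflations_lift {X Y D : C} {f : X ⟶ Y} (hf : 𝓔.inflations f) (a : X ⟶ D) :
    𝓔.inflations (biprod.lift f a) := by
  have h₁ : 𝓔.inflations (biprod.inl ≫ (shear a).hom) :=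
    inflations_comp_iso ⟨_, _, _, 𝓔.realize_zero X D⟩ _
  obtain ⟨Z, g, δ, h⟩ := hf
  convert inflations_comp h₁ ⟨_, _, _, isTriangle_biprod_map_id h D⟩
  ext <;> simp

lemma deflations_desc {Y Z D : C} {g : Y ⟶ Z} (hg : 𝓔.deflations g) (c : D ⟶ Z) :
    𝓔.deflations (biprod.desc g c) := by
  have h₁ : 𝓔.deflations ((biprod.braiding Z D ≪≫ shear c).hom ≫ biprod.snd) :=
    deflations_iso_comp ⟨_, _, _, 𝓔.realize_zero D Z⟩ _
  obtain ⟨X, f, δ, h⟩ := hg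
  convert deflations_comp ⟨_, _, _, isTriangle_biprod_map_id' h D⟩ h₁
  ext <;> simp

/-- Row reduction: subtracting g applied to f clears the component gf of the inflation (gf, f). -/
lemma inflations_lift_zero_of_comp {X Y Z : C} (f : X ⟶ Y) (g : Y ⟶ Z)
    (h : 𝓔.inflations (f ≫ g)) : 𝓔.inflations (biprod.lift f (0 : X ⟶ Z)) := by
  convert inflations_comp_iso (inflations_lift h f) (biprod.braiding Z Y ≪≫ shear (-g))
  ext <;> simp

lemma deflations_desc_zero_of_comp {X Y Z : C} (f : X ⟶ Y) (g : Y ⟶ Z)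
    (h : 𝓔.deflations (f ≫ g)) : 𝓔.deflations (biprod.desc g (0 : X ⟶ Z)) := by
  convert deflations_iso_comp (deflations_desc h g) (biprod.braiding Y X ≪≫ shear (-f))
  ext <;> simp

end Classes

/-! ### The implications between the conditions -/

section Implications

lemma inflations_of_lift_zero (hC : WeaklyIdempotentComplete C) {X Y : C} (i : X ⟶ Y) (Z : C)
    (h : 𝓔.inflations (biprod.lift i 0 : X ⟶ Y ⊞ Z)) : 𝓔.inflations i := by
  obtain ⟨W, g, δ, h⟩ := h
  obtain ⟨r, hr⟩ := exists_desc h biprod.snd (by simp)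
  obtain ⟨D, ρ, x, h₁, h₂, h₃, h₄⟩ := hC.exists_complement (biprod.inr ≫ g) r (by simp [hr])
  refine ⟨D, biprod.inl ≫ g ≫ ρ, _, isTriangle_of_biprod_map_id' (W := Z)
    (isTriangle_of_iso h (Iso.refl _) (Iso.refl _)
      ⟨biprod.lift ρ r, biprod.desc x (biprod.inr ≫ g), by simp [h₄], ?_⟩ (by simp) ?_)⟩
  · simp only [Category.assoc] at h₁
    ext <;> simp [h₁, h₂, h₃, hr]
  · simp only [Category.assoc] at h₁
    ext <;> simp [h₁, hr]

lemma deflations_of_desc_zero (hC : WeaklyIdempotentComplete C) {X Y : C} (p : X ⟶ Y) (Z : C)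
    (h : 𝓔.deflations (biprod.desc p 0 : X ⊞ Z ⟶ Y)) : 𝓔.deflations p := by
  obtain ⟨F, a, δ, h⟩ := h
  -- (p, 0) vanishes on Z, so Z lifts to the first term F, and `a ≫ biprod.snd` retracts the lift:
  -- now Z splits off F.
  obtain ⟨τ, hτ⟩ := exists_lift h biprod.inr (by simp)
  obtain ⟨D, ρ, x, h₁, h₂, h₃, h₄⟩ := hC.exists_complement τ (a ≫ biprod.snd)
    (by simp [reassoc_of% hτ])
  refine ⟨D, x ≫ a ≫ biprod.fst, _, isTriangle_of_biprod_map_id (W := Z)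
    (isTriangle_of_iso h
      ⟨biprod.lift ρ (a ≫ biprod.snd), biprod.desc x τ, by simp [h₄], ?_⟩ (Iso.refl _)
      (Iso.refl _) ?_ (by simp))⟩
  · ext <;> simp [h₁, h₂, h₃, reassoc_of% hτ]
  · rw [← Iso.inv_comp_eq]
    ext <;> simp [h₃, hτ]

lemma hasCokernel_of_inflations {X Y : C} {φ : X ⟶ Y} (h : 𝓔.inflations φ) (ψ : Y ⟶ X)
    (hφ : φ ≫ ψ = 𝟙 X) : HasCokernel φ := by
  obtain ⟨Z, g, δ, h⟩ := h
  have hδ : δ = 0 := by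
    rw [← push_id δ, ← hφ, push_comp, push_self_eq_zero h, push_zero]
  obtain ⟨σ, hσ⟩ := exists_lift_of_pull_eq_zero h (𝟙 Z) (by simp [hδ])
  obtain ⟨t, ht⟩ := exists_desc h (𝟙 Y - ψ ≫ φ) (by simp [reassoc_of% hφ])
  have hg := comp_eq_zero h
  refine hasCokernel_of_complement φ ψ g t hg ?_ ht
  rw [← Category.id_comp (t ≫ g), ← hσ, Category.assoc, reassoc_of% ht]
  simp [hg, hσ]

lemma hasCokernel_of_deflations {X Y : C} (φ : X ⟶ Y) {ψ : Y ⟶ X} (h : 𝓔.deflations ψ)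
    (hφ : φ ≫ ψ = 𝟙 X) : HasCokernel φ := by
  obtain ⟨A, f, δ, h⟩ := h
  obtain ⟨ρ, h₁, h₂, h₃⟩ := exists_splitting h φ hφ
  exact hasCokernel_of_complement φ ψ ρ f h₂ h₁ h₃

/-- The section on the sources composes to an identity, hence is an inflation by cancellation; thus
`f ≫ r.i.right` is a composite of inflations. -/
lemma inflations_isStableUnderRetracts
    (h : ∀ ⦃X Y Z : C⦄ (f : X ⟶ Y) (g : Y ⟶ Z), 𝓔.inflations (f ≫ g) → 𝓔.inflations f) :
    𝓔.inflations.IsStableUnderRetracts where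
  of_retract {X Y Z W f g} r hg := by
    have h₁ : 𝓔.inflations r.i.left := h _ r.r.left (by
      rw [r.retract_left]; exact ⟨_, _, _, isTriangle_id X⟩)
    refine h f r.i.right ?_
    rw [← r.i_w]
    exact inflations_comp h₁ hg

lemma deflations_isStableUnderRetracts
    (h : ∀ ⦃X Y Z : C⦄ (f : X ⟶ Y) (g : Y ⟶ Z), 𝓔.deflations (f ≫ g) → 𝓔.deflations g) :
    𝓔.deflations.IsStableUnderRetracts where
  of_retract {X Y Z W f g} r hg := by
    have h₁ : 𝓔.deflations r.r.right := h r.i.right _ (by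
      rw [r.retract_right]; exact ⟨_, _, _, isTriangle_id' Y⟩)
    refine h r.r.left f ?_
    rw [r.r_w]
    exact deflations_comp hg h₁

open ZeroObject in
lemma inflations_of_threeByThreeLemma (h : 𝓔.ThreeByThreeLemma) {X Y : C} (i : X ⟶ Y) (Z : C)
    (hi : 𝓔.inflations (biprod.lift i 0 : X ⟶ Y ⊞ Z)) : 𝓔.inflations i := by
  obtain ⟨W, p, ε, hi⟩ := hi
  obtain ⟨C₁, fC, gC, δC, i₁, p₁, ε₁, H⟩ := h _ _ _ _ _ _ _ _ _ _ _ _ (isTriangle_id X)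
    (𝓔.realize_zero Y Z) hi (isTriangle_id' Z) (by simp)
  have e : i₁ = i := by
    simpa using congrArg (· ≫ biprod.fst) H.mor_i.comm₁.symm
  exact ⟨_, _, _, e ▸ H.col₁⟩

/-! ### Constructions for the 3 × 3 Lemma -/

/-- Two `𝔼`-triangles with the same third term have a common "pullback", given by the middle term
of the sum of both extensions. -/
lemma exists_common_extension {A₁ B₁ A₂ B₂ Z : C} {x₁ : A₁ ⟶ B₁} {y₁ : B₁ ⟶ Z} {δ₁ : 𝓔.Ext Z A₁}
    {x₂ : A₂ ⟶ B₂} {y₂ : B₂ ⟶ Z} {δ₂ : 𝓔.Ext Z A₂} (h₁ : 𝓔.IsTriangle x₁ y₁ δ₁)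
    (h₂ : 𝓔.IsTriangle x₂ y₂ δ₂) :
    ∃ (M : C) (m₁ : A₁ ⟶ M) (e₂ : M ⟶ B₂) (m₂ : A₂ ⟶ M) (e₁ : M ⟶ B₁),
      𝓔.IsTriangle m₁ e₂ (pull y₂ δ₁) ∧ 𝓔.IsTriangle m₂ e₁ (pull y₁ δ₂) ∧
      m₁ ≫ e₁ = x₁ ∧ m₂ ≫ e₂ = x₂ ∧ e₁ ≫ y₁ = e₂ ≫ y₂ ∧ push m₁ δ₁ + push m₂ δ₂ = 0 := by
  obtain ⟨M, j, r, hM⟩ := exists_isTriangle (push biprod.inl δ₁ + push biprod.inr δ₂)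
  -- Dividing the realization of the summed extension by one summand, via (ET4) and the split
  -- triangle, leaves a realization of the other component. Stated for a general splitting so as to
  -- serve both summands.
  have aux : ∀ {A A' B : C} (i : A ⟶ A₁ ⊞ A₂) (p : A₁ ⊞ A₂ ⟶ A) (i' : A' ⟶ A₁ ⊞ A₂)
      (p' : A₁ ⊞ A₂ ⟶ A') (x : A' ⟶ B) (y : B ⟶ Z) (δ : 𝓔.Ext Z A) (δ' : 𝓔.Ext Z A')
      (_ : 𝓔.IsTriangle x y δ') (_ : 𝓔.IsTriangle i p' 0) (_ : i ≫ p = 𝟙 A) (_ : i' ≫ p' = 𝟙 A')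
      (_ : push p (push biprod.inl δ₁ + push biprod.inr δ₂) = δ)
      (_ : push p' (push biprod.inl δ₁ + push biprod.inr δ₂) = δ'),
      ∃ e : M ⟶ B, 𝓔.IsTriangle (i ≫ j) e (pull y δ) ∧ i' ≫ j ≫ e = x ∧ e ≫ y = r := by
    intro A A' B i p i' p' x y δ δ' h hi hip hip' hp hp'
    obtain ⟨F, m, k, θ, c, q, η, t₁, t₂, rfl, u₂, u₃, -, rfl, u₆⟩ := 𝓔.et4 i p' 0 j r _ hi hM
    rw [hp'] at t₂
    obtain ⟨φ, v₁, v₂⟩ := t₂.exists_iso h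
    have hθ : θ = pull q δ := by
      have := congrArg (push p) u₆
      rwa [← push_comp, hip, push_id, push_pull, hp] at this
    refine ⟨k ≫ φ.hom, ?_, ?_, by simp [v₂, u₃]⟩
    · have := isTriangle_of_iso t₁ (f' := i ≫ j) (g' := k ≫ φ.hom) (Iso.refl _) (Iso.refl _) φ
        (by simp) (by simp)
      rw [hθ, Iso.refl_hom, push_id, ← pull_comp] at this
      rwa [← v₂, Iso.inv_hom_id_assoc] at this
    · rw [reassoc_of% u₂, v₁, reassoc_of% hip']
  obtain ⟨e₂, a₁, a₂, a₃⟩ := aux biprod.inl biprod.fst biprod.inr biprod.snd x₂ y₂ δ₁ δ₂ h₂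
    (𝓔.realize_zero _ _) (by simp) (by simp) (by simp [← push_comp]) (by simp [← push_comp])
  have hs : 𝓔.IsTriangle (biprod.inr : A₂ ⟶ A₁ ⊞ A₂) biprod.fst 0 := by
    simpa using isTriangle_of_iso (𝓔.realize_zero A₂ A₁) (f' := (biprod.inr : A₂ ⟶ A₁ ⊞ A₂))
      (g' := biprod.fst) (Iso.refl _) (biprod.braiding _ _) (Iso.refl _) (by ext <;> simp)
      (by simp)
  obtain ⟨e₁, b₁, b₂, b₃⟩ := aux biprod.inr biprod.snd biprod.inl biprod.fst x₁ y₁ δ₂ δ₁ h₁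
    hs (by simp) (by simp) (by simp [← push_comp]) (by simp [← push_comp])
  refine ⟨M, biprod.inl ≫ j, e₂, biprod.inr ≫ j, e₁, a₁, b₁, by simpa using b₂, by simpa using a₂,
    by rw [a₃, b₃], ?_⟩
  rw [push_comp, push_comp, ← push_add, push_self_eq_zero hM]

/-- Given a morphism `(i, l, 1)` from an `𝔼`-triangle `A₁ ⟶ A₂ ⟶ Z` to an `𝔼`-triangle
`B₁ ⟶ K ⟶ Z` of which `l` is given and is an inflation, one can choose `i` to be an inflation
with the same third term as `l`. -/
lemma exists_inflation_of_inflation_mid {A₁ A₂ B₁ K Z D : C}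
    {fA : A₁ ⟶ A₂} {gA : A₂ ⟶ Z} {δA : 𝓔.Ext Z A₁} {fK : B₁ ⟶ K} {k : K ⟶ Z} {δK : 𝓔.Ext Z B₁}
    {l : A₂ ⟶ K} {s : K ⟶ D} {ζ : 𝓔.Ext D A₂} (hA : 𝓔.IsTriangle fA gA δA)
    (hK : 𝓔.IsTriangle fK k δK) (hl : 𝓔.IsTriangle l s ζ) (hlk : l ≫ k = gA) :
    ∃ (i : A₁ ⟶ B₁) (ε : 𝓔.Ext D A₁), 𝓔.IsTriangle i (fK ≫ s) ε ∧ i ≫ fK = fA ≫ l ∧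
      push i δA = δK ∧ push fA ε = ζ := by
  obtain ⟨M, m₁, eA, m₂, eK, t₁, t₂, h₁, h₂, h₃, h₄⟩ := exists_common_extension hK hA
  -- Since gA factors through k by l, the extension of A₂ by B₁ with middle term M splits, and M ≅
  -- B₁ ⊕ A₂.
  obtain ⟨σ, hσ₁, hσ₂⟩ := exists_weakPullback_lift t₁ hK h₁ h₃ rfl (𝟙 A₂) l (by simp [hlk])
  obtain ⟨ρ, r₁, r₂, r₃⟩ := exists_splitting t₁ σ hσ₁
  have r₃' : ρ ≫ m₁ + eA ≫ σ = 𝟙 M := by rw [r₃]; abel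
  have hi : (m₂ ≫ ρ) ≫ fK + fA ≫ l = 0 := by
    have := congrArg (m₂ ≫ · ≫ eK) r₃'
    simpa [h₁, hσ₂, reassoc_of% h₂, comp_eq_zero t₂] using this
  have hδ : δK + push (m₂ ≫ ρ) δA = 0 := by
    have := congrArg (push ρ) h₄
    simpa [← push_comp, r₁] using this
  -- F is the weak pullback of eK : M → K along l. The section σ of eA lifts l through eK and so
  -- induces a section of F → A₂, whence F ≅ A₁ ⊕ A₂.
  obtain ⟨F, f, g, δ, a, b, ε, hF, ha, u₁, u₂, rfl, rfl, u₅, u₆⟩ := 𝓔.et4_op m₂ eK _ l s ζ t₂ hl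
  obtain ⟨τ, hτ₁, hτ₂⟩ := exists_weakPullback_lift hF t₂ u₁ u₂ rfl (𝟙 A₂) σ (by simp [hσ₂])
  obtain ⟨π, p₁, p₂, p₃⟩ := exists_splitting hF τ hτ₁
  have p₃' : π ≫ f + g ≫ τ = 𝟙 F := by rw [p₃]; abel
  have hfg := comp_eq_zero hF
  have hls := comp_eq_zero hl
  -- The term `π ≫ fA` makes the second coordinate equal to `a ≫ eA`, so that the inflation a
  -- becomes diagonal with identity A₂-entry.
  let Φ : F ≅ A₁ ⊞ A₂ :=
    { hom := biprod.lift π (g + π ≫ fA)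
      inv := biprod.desc (f - fA ≫ τ) τ
      hom_inv_id := by simp [← p₃']
      inv_hom_id := by
        ext <;> simp [hτ₁, p₁, p₂, reassoc_of% p₁, reassoc_of% p₂, hfg] }
  let Ψ : M ≅ B₁ ⊞ A₂ :=
    { hom := biprod.lift ρ eA
      inv := biprod.desc m₁ σ
      hom_inv_id := by simp [r₃']
      inv_hom_id := by ext <;> simp [r₁, r₂, hσ₁, comp_eq_zero t₁] }
  have hΦ : 𝓔.IsTriangle (biprod.map (m₂ ≫ ρ) (𝟙 A₂)) (biprod.desc (fK ≫ s) 0)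
      (push Φ.hom (pull (𝟙 D) ε)) := by
    refine isTriangle_of_iso ha Φ Ψ (Iso.refl D) ?_ ?_
    · rw [← Iso.inv_comp_eq]
      ext <;> simp [Φ, Ψ, reassoc_of% u₁, reassoc_of% hτ₂, r₂, hσ₁, h₂]
    · rw [Iso.refl_hom, Category.comp_id, ← Iso.inv_comp_eq]
      ext <;> simp [Ψ, reassoc_of% h₁, reassoc_of% hσ₂, hls]
  have h_zero : push (g + π ≫ fA) ε = 0 := by
    have e : g + π ≫ fA = a ≫ eA := by
      rw [← Iso.cancel_iso_inv_left Φ]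
      ext <;> simp [Φ, reassoc_of% u₁, reassoc_of% hτ₂, hσ₁, hτ₁, h₂, hfg, reassoc_of% p₁,
        reassoc_of% p₂]
    rw [e, push_comp, push_self_eq_zero ha, push_zero]
  have h_push : push Φ.hom (pull (𝟙 D) ε) = push biprod.inl (push π ε) := by
    have e : Φ.hom = π ≫ biprod.inl + (g + π ≫ fA) ≫ biprod.inr := by
      ext <;> simp [Φ]
    rw [pull_id, e, add_push, push_comp, push_comp _ biprod.inr, h_zero, push_zero, add_zero]
  have hc := isTriangle_of_biprod_map_id hΦ
  -- The sign stems from the relation `push m₁ δK + push m₂ δA = 0` on M.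
  refine ⟨-(m₂ ≫ ρ), _, isTriangle_neg hc, ?_, ?_, ?_⟩
  · rw [Preadditive.neg_comp, neg_eq_iff_add_eq_zero, hi]
  · rw [neg_push, neg_eq_iff_add_eq_zero, add_comm, hδ]
  · rw [push_neg, neg_eq_iff_add_eq_zero, h_push, ← push_comp biprod.inl, biprod.inl_fst, push_id,
      ← push_comp, ← u₅, ← add_push, add_comm, h_zero]

lemma threeByThreeLemma (hC : WeaklyIdempotentComplete C) : 𝓔.ThreeByThreeLemma := by
  intro A₁ A₂ A₃ B₁ B₂ B₃ C₂ C₃ fA gA δA fB gB δB i₂ p₂ ε₂ i₃ p₃ ε₃ hA hB h₂ h₃ hsq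
  obtain ⟨K, fK, k, δK, a, b, ε, hK, ha, e₁, e₂, rfl, rfl, rfl, e₆⟩ :=
    𝓔.et4_op fB gB δB i₃ p₃ ε₃ hB h₃
  obtain ⟨l, hlk, hla⟩ := exists_weakPullback_lift hK hB e₁ e₂ rfl gA i₂ hsq.symm
  obtain ⟨C₁, s, ζ, hl⟩ : 𝓔.inflations l :=
    inflations_of_lift_zero hC l B₂
      (inflations_lift_zero_of_comp l a (hla ▸ ⟨_, _, _, h₂⟩))
  obtain ⟨F, m, h, θ, c, q, η, hm, hc, rfl, u₂, u₃, rfl, rfl, u₆⟩ := 𝓔.et4 l s ζ a _ ε hl ha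
  rw [hla] at hm
  -- (ET4) gives some third term F for the inflation i₂; it must be identified with the prescribed
  -- C₂.
  obtain ⟨γ, hγ, rfl⟩ := exists_iso_of_same_inflation hm h₂
  obtain ⟨i₁, ε₁, hi₁, v₁, v₂, v₃⟩ := exists_inflation_of_inflation_mid hA hK hl hlk
  have hγ' : p₂ ≫ γ.inv = h := by rw [← hγ]; simp
  refine ⟨C₁, c ≫ γ.hom, γ.inv ≫ q, push s ε, i₁, fK ≫ s, ε₁, hA, hB,
    hc.of_mid_iso γ rfl (by simp), hi₁, h₂, h₃, ⟨?_, hsq.symm, v₂⟩, ⟨?_, ?_, ?_⟩, ⟨?_, ?_, ?_⟩,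
    ⟨hsq, ?_, ?_⟩⟩
  · rw [← e₁, reassoc_of% v₁, hla]
  · rw [← e₁, ← hγ, Category.assoc, Category.assoc, reassoc_of% u₂]
  · rw [reassoc_of% hγ', u₃]
  · rw [push_comp, e₆, push_pull]
  · rw [← e₁, reassoc_of% v₁, hla]
  · rw [← e₁, ← hγ, Category.assoc, Category.assoc, reassoc_of% u₂]
  · rw [v₃, pull_comp]
  · rw [reassoc_of% hγ', u₃]
  · have : push l ε₂ = pull (γ.inv ≫ q) ε := by
      rw [pull_comp, ← u₆, push_pull, ← pull_comp, γ.inv_hom_id, pull_id]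
    rw [← hlk, push_comp, this, push_pull]

end Implications

end Extriangulated

end Extri

theorem proposition7p1 {C : Type u} [Category.{v} C] [Preadditive C] [HasZeroObject C]
    [HasBinaryBiproducts C] (𝓔 : Extri.Extriangulated.{w} C) :
    List.TFAE
      [ -- weak idempotent completeness
        Extri.WeaklyIdempotentComplete C,
        -- cancellation for inflations and for deflations
        ∀ ⦃X Y Z : C⦄ (f : X ⟶ Y) (g : Y ⟶ Z), 𝓔.inflations (f ≫ g) → 𝓔.inflations f,
        ∀ ⦃X Y Z : C⦄ (f : X ⟶ Y) (g : Y ⟶ Z), 𝓔.deflations (f ≫ g) → 𝓔.deflations g,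
        -- closure under retracts
        𝓔.inflations.IsStableUnderRetracts,
        𝓔.deflations.IsStableUnderRetracts,
        -- cancellation of a zero component
        ∀ ⦃X Y : C⦄ (i : X ⟶ Y) (Z : C),
          𝓔.inflations (biprod.lift i 0 : X ⟶ Y ⊞ Z) → 𝓔.inflations i,
        ∀ ⦃X Y : C⦄ (p : X ⟶ Y) (Z : C),
          𝓔.deflations (biprod.desc p 0 : X ⊞ Z ⟶ Y) → 𝓔.deflations p,
        -- the 3 × 3 Lemma
        𝓔.ThreeByThreeLemma ] := by
  tfae_have 1 → 6 := fun h _ _ => Extri.Extriangulated.inflations_of_lift_zero h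
  tfae_have 1 → 7 := fun h _ _ => Extri.Extriangulated.deflations_of_desc_zero h
  tfae_have 6 → 2 := fun h _ _ _ f g hfg =>
    h _ _ (Extri.Extriangulated.inflations_lift_zero_of_comp f g hfg)
  tfae_have 7 → 3 := fun h _ _ _ f g hfg =>
    h _ _ (Extri.Extriangulated.deflations_desc_zero_of_comp f g hfg)
  tfae_have 2 → 4 := Extri.Extriangulated.inflations_isStableUnderRetracts
  tfae_have 3 → 5 := Extri.Extriangulated.deflations_isStableUnderRetracts
  tfae_have 4 → 6 := fun h X Y i Z hi =>
    h.of_retract (g := biprod.lift i 0)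
      { i := Arrow.homMk (𝟙 X) biprod.inl (by dsimp; ext <;> simp)
        r := Arrow.homMk (𝟙 X) biprod.fst (by simp)
        retract := by ext <;> simp } hi
  tfae_have 5 → 7 := fun h X Y p Z hp =>
    h.of_retract (g := biprod.desc p 0)
      { i := Arrow.homMk biprod.inl (𝟙 Y) (by simp)
        r := Arrow.homMk biprod.fst (𝟙 Y) (by dsimp; ext <;> simp)
        retract := by ext <;> simp } hp
  tfae_have 2 → 1 := fun h A B φ ⟨ψ, hφ⟩ =>
    Extri.Extriangulated.hasCokernel_of_inflations
      (h φ ψ (hφ ▸ ⟨_, _, _, Extri.Extriangulated.isTriangle_id A⟩)) ψ hφ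
  tfae_have 3 → 1 := fun h A B φ ⟨ψ, hφ⟩ =>
    Extri.Extriangulated.hasCokernel_of_deflations φ
      (h φ ψ (hφ ▸ ⟨_, _, _, Extri.Extriangulated.isTriangle_id' A⟩)) hφ
  tfae_have 1 → 8 := Extri.Extriangulated.threeByThreeLemma
  tfae_have 8 → 6 := fun h _ _ => Extri.Extriangulated.inflations_of_threeByThreeLemma h
  tfae_finish
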